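/- A *metric graph* $\mathcal G$ is a connected space obtained from a finite multigraph (multiple edges and self-loops allowed) in which every edge $e$ is either a bounded interval $[0,\ell_e]$ with $0<\ell_e<\infty$, attached to vertices at both endpoints, or a half-line $[0,\infty)$, attached to a vertex at $0$ only. It carries Lebesgue measure on each edge, and $L^r(\mathcal G)$ is taken with respect to this measure. $H^1(\mathcal G)$ is the space of continuous functions $u:\mathcal G\to\mathbb R$ with $u\in L^2(\mathcal G)$ whose weak derivative $u'$, taken along each edge, exists and belongs to $L^2(\mathcal G)$. **Proposition 2.1 (universal Gagliardo–Nirenberg inequality).** For every $p\in(2,6)$ there exists a constant $C_p\in(0,\infty)$, depending only on $p$, such that for every noncompact metric graph $\mathcal G$ and every $u\in H^1(\mathcal G)$, $$\|u\|_{L^p(\mathcal G)}^p\le C_p\,\|u\|_{L^2(\mathcal G)}^{\frac p2+1}\,\|u'\|_{L^2(\mathcal G)}^{\frac p2-1}.$$ -/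

import Mathlib

open MeasureTheory
open scoped ENNReal NNReal ContDiff

noncomputable section

/-- The combinatorial and metric data of a metric graph with vertex set `V` and edge set `E`.
Multiple edges and self-loops are allowed. An edge `e` of finite length is an interval
`[0, length e]`, attached to the vertex `origin e` at `0` and to the vertex `terminus e _` at
`length e`. An edge of infinite length is a half-line `[0, ∞)`, attached to the graph only at `0`,
where it meets the vertex `origin e`. -/
structure MetricGraph (V E : Type*) where
  length : E → ℝ≥0∞
  length_pos : ∀ e, 0 < length e
  origin : E → V
  terminus : ∀ e, length e ≠ ⊤ → V

namespace MetricGraph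

variable {V E : Type*} (G : MetricGraph V E)

/-- The interval of coordinates on the edge `e`: `[0, length e]` or `[0, ∞)`. -/
def interval (e : E) : Set ℝ := {x | 0 ≤ x ∧ ENNReal.ofReal x ≤ G.length e}

/-- The disjoint union of all the vertices and all the edges, before gluing. -/
def PrePoint : Type _ := V ⊕ (Σ e : E, G.interval e)

/-- Disjoint union topology; the vertices are isolated points before gluing. -/
instance : TopologicalSpace G.PrePoint :=
  letI : TopologicalSpace V := ⊥
  inferInstanceAs (TopologicalSpace (V ⊕ (Σ e : E, G.interval e)))

/-- The endpoints of the edges are glued to the vertices. -/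
inductive Glue : G.PrePoint → G.PrePoint → Prop
  | origin (e : E) (x : G.interval e) (hx : (x : ℝ) = 0) :
      Glue (Sum.inl (G.origin e)) (Sum.inr ⟨e, x⟩)
  | terminus (e : E) (he : G.length e ≠ ⊤) (x : G.interval e)
      (hx : (x : ℝ) = (G.length e).toReal) :
      Glue (Sum.inl (G.terminus e he)) (Sum.inr ⟨e, x⟩)

/-- The metric graph as a space, with the quotient topology. When there are finitely many edges,
this is the topology of the shortest path distance. -/
def Space : Type _ := Quot G.Glue

instance : TopologicalSpace G.Space := inferInstanceAs (TopologicalSpace (Quot G.Glue))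

instance : MeasurableSpace G.Space := borel G.Space

instance : BorelSpace G.Space := ⟨rfl⟩

/-- The point of the graph with coordinate `x` on the edge `e`. -/
def onEdge (e : E) (x : G.interval e) : G.Space := Quot.mk G.Glue (Sum.inr ⟨e, x⟩)

/-- Lebesgue measure on the edge `e`, in its coordinate. -/
def edgeMeasure (e : E) : Measure (G.interval e) := volume.comap (fun x => (x : ℝ))

/-- Lebesgue measure on the graph: the sum of the Lebesgue measures of the edges. -/
instance : MeasureSpace G.Space where
  volume := Measure.sum fun e => (G.edgeMeasure e).map (G.onEdge e)

/-- `u'` is the weak derivative of `u`: on each edge, it is the weak derivative with respect to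
the coordinate of that edge, tested against the smooth functions with compact support in the
interior of the edge. -/
def HasWeakDeriv (u u' : G.Space → ℝ) : Prop :=
  ∀ (e : E) (φ : ℝ → ℝ), ContDiff ℝ ∞ φ → HasCompactSupport φ →
    tsupport φ ⊆ interior (G.interval e) →
    ∫ x : G.interval e, u (G.onEdge e x) * deriv φ x ∂(G.edgeMeasure e) =
      -∫ x : G.interval e, u' (G.onEdge e x) * φ x ∂(G.edgeMeasure e)

/-- `u` belongs to `H¹(G)` and `u'` is its weak derivative: `u` is continuous on the graph, in
particular at the vertices, and it lies in `L²(G)` together with its weak derivative `u'`. -/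
structure IsH1 (u u' : G.Space → ℝ) : Prop where
  continuous : Continuous u
  memLp : MemLp u 2 volume
  hasWeakDeriv : G.HasWeakDeriv u u'
  memLp_deriv : MemLp u' 2 volume

end MetricGraph

end

/-! The inequality follows by interpolation from the sup bound `‖u‖_∞² ≤ 2 ‖u‖₂ ‖u'‖₂`, since `|u|^p
≤ ‖u‖_∞^(p-2) |u|²`; this gives the constant `2^(p/2-1)`.

For the sup bound (`IsH1.enorm_sq_le`), a noncompact graph with finitely many edges has a half-line,
on which `u²` takes arbitrarily small values because `u` is in `L²`. The graph is connected, so `u²`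
attains every value in `(0, u(x)²]`, each on some edge. Hence `u(x)²` is at most the sum over the
edges of the measures of their images under `u²`, and each image has measure at most the integral of
`2|u u'|` along its edge. Cauchy–Schwarz concludes. Counting values of `u²` avoids choosing a path
from `x` to infinity.

The edge estimate rests on `eqOn_add_integral_of_weakDeriv`, which makes `u` absolutely continuous
along bounded pieces of an edge. -/

/-! ### Weak derivatives on a bounded interval -/

section WeakDerivative

open Set

/-- **Du Bois-Reymond lemma**: a continuous function on `[a, b]` whose weak derivative vanishes
is constant. -/
theorem exists_eqOn_const_of_integral_mul_deriv_eq_zero {h : ℝ → ℝ} {a b : ℝ} (hab : a < b)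
    (hh : ContinuousOn h (Icc a b))
    (H : ∀ φ : ℝ → ℝ, ContDiff ℝ ∞ φ → HasCompactSupport φ → tsupport φ ⊆ Ioo a b →
      ∫ x in a..b, h x * deriv φ x = 0) :
    ∃ c, EqOn h (fun _ => c) (Icc a b) := by
  have key : ∀ θ : ℝ → ℝ, ContDiff ℝ ∞ θ → HasCompactSupport θ → tsupport θ ⊆ Ioo a b →
      ∫ x in a..b, θ x = 0 → ∫ x in a..b, h x * θ x = 0 := by
    intro θ hθ hθc hθs hθ0
    -- Adding the midpoint keeps the set nonempty when `θ = 0`.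
    obtain ⟨c, hc, hcl⟩ := (hθc.isCompact.insert ((a + b) / 2)).exists_isLeast (insert_nonempty _ _)
    obtain ⟨d, hd, hdl⟩ :=
      (hθc.isCompact.insert ((a + b) / 2)).exists_isGreatest (insert_nonempty _ _)
    have hins : insert ((a + b) / 2) (tsupport θ) ⊆ Ioo a b :=
      insert_subset ⟨by linarith, by linarith⟩ hθs
    have hac := (hins hc).1
    have hdb := (hins hd).2
    have hlow : ∀ x, x < c → θ x = 0 := fun x hx =>
      image_eq_zero_of_notMem_tsupport fun hx' => absurd (hcl (mem_insert_of_mem _ hx')) (by linarith)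
    have hhigh : ∀ x, d < x → θ x = 0 := fun x hx =>
      image_eq_zero_of_notMem_tsupport fun hx' => absurd (hdl (mem_insert_of_mem _ hx')) (by linarith)
    have hint : ∀ x y, IntervalIntegrable θ volume x y := fun x y =>
      hθ.continuous.intervalIntegrable x y
    -- Zero mean makes this primitive of `θ` vanish beyond `d` as well as before `c`, so it is an
    -- admissible test function.
    set φ : ℝ → ℝ := fun x => ∫ t in a..x, θ t with hφ
    have hderiv : deriv φ = θ := funext fun x => hθ.continuous.deriv_integral θ a x
    have hφs : tsupport φ ⊆ Icc c d := by
      refine closure_minimal (fun x hx => ?_) isClosed_Icc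
      by_contra hx'
      apply hx
      rw [mem_Icc, not_and_or, not_le, not_le] at hx'
      rcases hx' with hx' | hx'
      · refine intervalIntegral.integral_zero_ae (Filter.Eventually.of_forall fun t ht => hlow t ?_)
        rcases mem_uIoc.1 ht with ht | ht <;> linarith [ht.2]
      · change ∫ t in a..x, θ t = 0
        rw [← intervalIntegral.integral_add_adjacent_intervals (hint a b) (hint b x), hθ0, zero_add]
        refine intervalIntegral.integral_zero_ae (Filter.Eventually.of_forall fun t ht => hhigh t ?_)
        rcases mem_uIoc.1 ht with ht | ht <;> linarith [ht.1]
    have hφd : ContDiff ℝ ∞ φ := contDiff_infty_iff_deriv.2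
      ⟨fun x => (hθ.continuous.integral_hasStrictDerivAt a x).hasDerivAt.differentiableAt,
        hderiv ▸ hθ⟩
    have := H φ hφd (isCompact_Icc.of_isClosed_subset (isClosed_tsupport _) hφs)
      (hφs.trans fun x hx => ⟨hac.trans_le hx.1, hx.2.trans_lt hdb⟩)
    rwa [hderiv] at this
  have hm : (a + b) / 2 ∈ Ioo a b := ⟨by linarith, by linarith⟩
  obtain ⟨f, hf⟩ : ∃ f : ContDiffBump ((a + b) / 2), Metric.closedBall ((a + b) / 2) f.rOut ⊆ Ioo a b :=
    ⟨⟨(b - a) / 8, (b - a) / 4, by linarith, by linarith⟩, by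
      rw [Real.closedBall_eq_Icc]
      intro x hx
      constructor <;> linarith [hx.1, hx.2]⟩
  set η : ℝ → ℝ := f.normed volume with hη
  have hηs : tsupport η ⊆ Ioo a b := by rwa [hη, f.tsupport_normed_eq]
  have whole : ∀ w : ℝ → ℝ, tsupport w ⊆ Ioo a b → ∫ x in a..b, w x = ∫ x, w x := by
    intro w hw
    rw [intervalIntegral.integral_of_le hab.le]
    refine setIntegral_eq_integral_of_forall_compl_eq_zero fun x hx => ?_
    exact image_eq_zero_of_notMem_tsupport fun hx' => hx (Ioo_subset_Ioc_self (hw hx'))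
  have hη1 : ∫ x in a..b, η x = 1 := by rw [whole η hηs, f.integral_normed]
  have hηd : ContDiff ℝ ∞ η := f.contDiff_normed
  have hηc : HasCompactSupport η := f.hasCompactSupport_normed
  refine ⟨∫ x in a..b, h x * η x, ?_⟩
  set C := ∫ x in a..b, h x * η x with hC
  have hii : ∀ w : ℝ → ℝ, Continuous w → IntervalIntegrable (fun x => h x * w x) volume a b :=
    fun w hw => ContinuousOn.intervalIntegrable (by
      rw [uIcc_of_le hab.le]; exact hh.mul hw.continuousOn)
  have hae : ∀ᵐ x, x ∈ Ioo a b → h x - C = 0 := by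
    refine isOpen_Ioo.ae_eq_zero_of_integral_contDiff_smul_eq_zero ?_ ?_
    · exact ((hh.mono Ioo_subset_Icc_self).sub continuousOn_const).locallyIntegrableOn
        measurableSet_Ioo
    · intro ψ hψ hψc hψs
      set k := ∫ x in a..b, ψ x with hk
      have hψi : IntervalIntegrable ψ volume a b := hψ.continuous.intervalIntegrable a b
      have hηi : IntervalIntegrable η volume a b := hηd.continuous.intervalIntegrable a b
      have hsub : tsupport (fun x => ψ x - k * η x) ⊆ Ioo a b := by
        refine (closure_minimal (fun x hx => ?_)
          ((isClosed_tsupport ψ).union (isClosed_tsupport η))).trans (union_subset hψs hηs)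
        by_contra hx'
        rw [mem_union, not_or] at hx'
        apply hx
        simp [image_eq_zero_of_notMem_tsupport hx'.1, image_eq_zero_of_notMem_tsupport hx'.2]
      -- Removing from `ψ` its mean times the unit-mass bump `η` leaves a zero-mean test function.
      have h0 := key (fun x => ψ x - k * η x) (hψ.sub (contDiff_const.mul hηd))
        (hψc.sub (hηc.mul_left (f := fun _ => k))) hsub (by
          rw [intervalIntegral.integral_sub hψi (hηi.const_mul k),
            intervalIntegral.integral_const_mul, hη1, mul_one, sub_self])
      have e1 : ∫ x in a..b, h x * (ψ x - k * η x) = (∫ x in a..b, h x * ψ x) - k * C := by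
        rw [hC, ← intervalIntegral.integral_const_mul, ← intervalIntegral.integral_sub
          (hii ψ hψ.continuous) ((hii η hηd.continuous).const_mul k)]
        congr 1; ext x; ring
      have e2 : ∫ x in a..b, ψ x • (h x - C) = (∫ x in a..b, h x * ψ x) - C * k := by
        rw [hk, ← intervalIntegral.integral_const_mul, ← intervalIntegral.integral_sub
          (hii ψ hψ.continuous) (hψi.const_mul C)]
        congr 1; ext x; simp only [smul_eq_mul]; ring
      rw [← whole]
      · rw [e2]; linarith
      · refine (closure_mono fun x hx => ?_).trans hψs
        exact fun h0 => hx (by simp [h0])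
  refine Measure.eqOn_Icc_of_ae_eq volume hab.ne ?_ hh continuousOn_const
  rw [restrict_Ioo_eq_restrict_Icc.symm, Filter.EventuallyEq, ae_restrict_iff' measurableSet_Ioo]
  filter_upwards [hae] with x hx hxm using sub_eq_zero.1 (hx hxm)

theorem ae_deriv_const_add_integral_eq {g : ℝ → ℝ} {a b : ℝ} (c : ℝ)
    (hg : IntervalIntegrable g volume a b) :
    ∀ᵐ x, x ∈ uIcc a b → deriv (fun y => c + ∫ t in a..y, g t) x = g x := by
  filter_upwards [hg.ae_hasDerivAt_integral] with x hx hxm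
  exact ((hx hxm a left_mem_uIcc).const_add c).deriv

/-- A continuous function with integrable weak derivative is the integral of that derivative. -/
theorem eqOn_add_integral_of_weakDeriv {f g : ℝ → ℝ} {a b : ℝ} (hab : a < b)
    (hf : ContinuousOn f (Icc a b)) (hg : IntervalIntegrable g volume a b)
    (H : ∀ φ : ℝ → ℝ, ContDiff ℝ ∞ φ → HasCompactSupport φ → tsupport φ ⊆ Ioo a b →
      ∫ x in a..b, f x * deriv φ x = -∫ x in a..b, g x * φ x) :
    EqOn f (fun x => f a + ∫ t in a..x, g t) (Icc a b) := by
  have hac := hg.absolutelyContinuousOnInterval_intervalIntegral (c := a) left_mem_uIcc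
  have hGc : ContinuousOn (fun x => ∫ t in a..x, g t) (Icc a b) := by
    simpa [uIcc_of_le hab.le] using hac.continuousOn
  obtain ⟨c, hc⟩ := exists_eqOn_const_of_integral_mul_deriv_eq_zero hab (hf.sub hGc) (by
    intro φ hφ hφc hφs
    have hd : Continuous (deriv φ) := hφ.continuous_deriv (by simp)
    have hφac : AbsolutelyContinuousOnInterval φ a b :=
      (hφ.of_le (by simp)).contDiffOn.absolutelyContinuousOnInterval
    have hφa : φ a = 0 := image_eq_zero_of_notMem_tsupport fun h => lt_irrefl _ (hφs h).1
    have hφb : φ b = 0 := image_eq_zero_of_notMem_tsupport fun h => lt_irrefl _ (hφs h).2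
    have hG := hac.integral_mul_deriv_eq_deriv_mul hφac
    have hcongr : ∫ x in a..b, deriv (fun x => ∫ t in a..x, g t) x * φ x
        = ∫ x in a..b, g x * φ x := by
      refine intervalIntegral.integral_congr_ae ?_
      filter_upwards [ae_deriv_const_add_integral_eq 0 hg] with x hx hxm
      have := hx (uIoc_subset_uIcc hxm)
      simp only [zero_add] at this
      rw [this]
    rw [hφa, hφb, hcongr] at hG
    have hfi : IntervalIntegrable (fun x => f x * deriv φ x) volume a b :=
      ContinuousOn.intervalIntegrable (by
        rw [uIcc_of_le hab.le]; exact hf.mul hd.continuousOn)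
    have hGi : IntervalIntegrable (fun x => (∫ t in a..x, g t) * deriv φ x) volume a b :=
      ContinuousOn.intervalIntegrable (by
        rw [uIcc_of_le hab.le]; exact hGc.mul hd.continuousOn)
    have : ∫ x in a..b, (f x - ∫ t in a..x, g t) * deriv φ x
        = (∫ x in a..b, f x * deriv φ x) - ∫ x in a..b, (∫ t in a..x, g t) * deriv φ x := by
      rw [← intervalIntegral.integral_sub hfi hGi]
      congr 1; ext x; ring
    change ∫ x in a..b, (f x - ∫ t in a..x, g t) * deriv φ x = 0
    rw [this, H φ hφ hφc hφs, hG]; ring)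
  intro x hx
  have h1 := hc hx
  have h2 := hc (left_mem_Icc.2 hab.le)
  simp only [Pi.sub_apply, intervalIntegral.integral_same, sub_zero] at h1 h2
  simp only
  linarith

/-- On the interval `f` equals an absolutely continuous primitive of `g`, so the product rule gives
`(f²)' = 2fg` almost everywhere. -/
theorem abs_sq_sub_sq_le_integral_of_weakDeriv {f g : ℝ → ℝ} {a b : ℝ} (hab : a < b)
    (hf : ContinuousOn f (Icc a b)) (hg : IntervalIntegrable g volume a b)
    (H : ∀ φ : ℝ → ℝ, ContDiff ℝ ∞ φ → HasCompactSupport φ → tsupport φ ⊆ Ioo a b →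
      ∫ x in a..b, f x * deriv φ x = -∫ x in a..b, g x * φ x) :
    |f b ^ 2 - f a ^ 2| ≤ ∫ x in a..b, 2 * |f x * g x| := by
  have hF := eqOn_add_integral_of_weakDeriv hab hf hg H
  set F : ℝ → ℝ := fun x => f a + ∫ t in a..x, g t with hFdef
  have hac : AbsolutelyContinuousOnInterval F a b :=
    (contDiff_const (c := f a)).contDiffOn.absolutelyContinuousOnInterval.fun_add
      (hg.absolutelyContinuousOnInterval_intervalIntegral (c := a) left_mem_uIcc)
  have h := hac.integral_deriv_mul_eq_sub hac
  have hcongr : ∫ x in a..b, deriv F x * F x + F x * deriv F x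
      = ∫ x in a..b, 2 * (f x * g x) := by
    refine intervalIntegral.integral_congr_ae ?_
    filter_upwards [ae_deriv_const_add_integral_eq (f a) hg] with x hx hxm
    have hxm' := uIoc_subset_uIcc hxm
    rw [hx hxm', hF (by rwa [uIcc_of_le hab.le] at hxm')]
    ring
  rw [hcongr, ← hF (right_mem_Icc.2 hab.le), ← hF (left_mem_Icc.2 hab.le)] at h
  rw [pow_two, pow_two, ← h]
  refine (intervalIntegral.abs_integral_le_integral_abs hab.le).trans_eq ?_
  congr 1; ext x; rw [abs_mul, abs_two]

end WeakDerivative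

/-! ### Topology and measure of a metric graph -/

namespace MetricGraph

open Set

variable {V E : Type*} (G : MetricGraph V E)

theorem measurableSet_interval (e : E) : MeasurableSet (G.interval e) :=
  measurableSet_Ici.inter
    (measurableSet_le ENNReal.measurable_ofReal measurable_const)

theorem ordConnected_interval (e : E) : (G.interval e).OrdConnected :=
  ⟨fun _ hx _ hy _ hz => ⟨hx.1.trans hz.1, (ENNReal.ofReal_le_ofReal hz.2).trans hy.2⟩⟩

theorem isClosed_interval (e : E) : IsClosed (G.interval e) :=
  isClosed_Ici.inter (isClosed_le ENNReal.continuous_ofReal continuous_const)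

theorem isCompact_interval {e : E} (he : G.length e ≠ ⊤) : IsCompact (G.interval e) :=
  isCompact_Icc.of_isClosed_subset (G.isClosed_interval e)
    fun _ hx => ⟨hx.1, ((ENNReal.ofReal_le_iff_le_toReal he).1 hx.2)⟩

theorem continuous_onEdge (e : E) : Continuous (G.onEdge e) := by
  let _ : TopologicalSpace V := ⊥
  exact continuous_quot_mk.comp (continuous_inr.comp continuous_sigmaMk)

theorem isOpen_iff_preimage {s : Set G.Space} :
    IsOpen s ↔ ∀ e, IsOpen (G.onEdge e ⁻¹' s) := by
  let _ : TopologicalSpace V := ⊥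
  have : DiscreteTopology V := ⟨rfl⟩
  refine ⟨fun h e => h.preimage (G.continuous_onEdge e), fun h => ?_⟩
  refine isOpen_coinduced.2 (isOpen_sum_iff.2 ⟨isOpen_discrete _, isOpen_sigma_iff.2 h⟩)

/-- The union of the edges is clopen. Were it empty, the graph would be discrete and connected,
hence at most a point, hence compact. -/
theorem iUnion_range_onEdge [ConnectedSpace G.Space] [NoncompactSpace G.Space] :
    ⋃ e, range (G.onEdge e) = univ := by
  have hpre : ∀ e, G.onEdge e ⁻¹' (⋃ e, range (G.onEdge e)) = univ := fun e =>
    eq_univ_of_forall fun x => mem_iUnion.2 ⟨e, mem_range_self x⟩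
  have hclopen : IsClopen (⋃ e, range (G.onEdge e)) := by
    refine ⟨⟨G.isOpen_iff_preimage.2 fun e => ?_⟩, G.isOpen_iff_preimage.2 fun e => ?_⟩
    · rw [preimage_compl, hpre, compl_univ]; exact isOpen_empty
    · rw [hpre]; exact isOpen_univ
  refine (isClopen_iff.1 hclopen).resolve_left fun hempty => ?_
  have hE : IsEmpty E := ⟨fun e => by
    have h0 : (0 : ℝ) ∈ G.interval e := ⟨le_rfl, by simp⟩
    have : G.onEdge e ⟨0, h0⟩ ∈ ⋃ e, range (G.onEdge e) := mem_iUnion.2 ⟨e, mem_range_self _⟩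
    rwa [hempty] at this⟩
  have : DiscreteTopology G.Space :=
    discreteTopology_iff_forall_isOpen.2 fun s => G.isOpen_iff_preimage.2 fun e => hE.elim e
  have : Subsingleton G.Space := PreconnectedSpace.trivial_of_discrete
  exact noncompact_univ G.Space (subsingleton_univ.finite.isCompact)

theorem exists_length_eq_top [Finite E] [ConnectedSpace G.Space] [NoncompactSpace G.Space] :
    ∃ e, G.length e = ⊤ := by
  by_contra! h
  refine noncompact_univ G.Space ?_
  rw [← G.iUnion_range_onEdge]
  refine isCompact_iUnion fun e => ?_
  have := isCompact_iff_compactSpace.1 (G.isCompact_interval (h e))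
  exact isCompact_range (G.continuous_onEdge e)

/-- The restriction of a function to the edge `e`, extended by zero. -/
noncomputable def edgeFun (w : G.Space → ℝ) (e : E) (x : ℝ) : ℝ :=
  open Classical in if hx : x ∈ G.interval e then w (G.onEdge e ⟨x, hx⟩) else 0

variable {G}

theorem edgeFun_coe (w : G.Space → ℝ) (e : E) (x : G.interval e) :
    G.edgeFun w e x = w (G.onEdge e x) := dif_pos x.2

theorem continuousOn_edgeFun {w : G.Space → ℝ} (hw : Continuous w) (e : E) :
    ContinuousOn (G.edgeFun w e) (G.interval e) := by
  rw [continuousOn_iff_continuous_domRestrict]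
  exact (hw.comp (G.continuous_onEdge e)).congr fun x => (edgeFun_coe w e x).symm

theorem map_onEdge_le (e : E) : (G.edgeMeasure e).map (G.onEdge e) ≤ volume :=
  Measure.le_sum (fun e => (G.edgeMeasure e).map (G.onEdge e)) e

theorem memLp_edgeFun {w : G.Space → ℝ} {q : ℝ≥0∞} (hw : MemLp w q volume) (e : E) :
    MemLp (G.edgeFun w e) q (volume.restrict (G.interval e)) := by
  have h := (hw.mono_measure (map_onEdge_le e)).comp_of_map
    (G.continuous_onEdge e).measurable.aemeasurable
  rw [← map_comap_subtype_coe (G.measurableSet_interval e),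
    (MeasurableEmbedding.subtype_coe (G.measurableSet_interval e)).memLp_map_measure_iff]
  exact (memLp_congr_ae (Filter.Eventually.of_forall fun x => edgeFun_coe w e x)).2 h

theorem lintegral_eq_sum_edges {w : G.Space → ℝ≥0∞} (hw : AEMeasurable w volume) :
    ∫⁻ x, w x = ∑' e, ∫⁻ x, w (G.onEdge e x) ∂(G.edgeMeasure e) := by
  change ∫⁻ x, w x ∂(Measure.sum fun e => (G.edgeMeasure e).map (G.onEdge e)) = _
  rw [lintegral_sum_measure]
  exact tsum_congr fun e => lintegral_map' (hw.mono_measure (map_onEdge_le e))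
    (G.continuous_onEdge e).measurable.aemeasurable

theorem lintegral_edgeMeasure (e : E) (w : ℝ → ℝ≥0∞) :
    ∫⁻ x : G.interval e, w x ∂(G.edgeMeasure e) = ∫⁻ x in G.interval e, w x :=
  lintegral_subtype_comap (G.measurableSet_interval e) w

/-! ### Estimates along a single edge -/

/-- The weak derivative of `u` along an edge, on a subinterval of that edge. -/
theorem HasWeakDeriv.intervalIntegral_eq {u u' : G.Space → ℝ} (h : G.HasWeakDeriv u u') {e : E}
    {a b : ℝ} (hab : a < b) (hsub : Icc a b ⊆ G.interval e) (φ : ℝ → ℝ) (hφ : ContDiff ℝ ∞ φ)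
    (hφc : HasCompactSupport φ) (hφs : tsupport φ ⊆ Ioo a b) :
    ∫ x in a..b, G.edgeFun u e x * deriv φ x = -∫ x in a..b, G.edgeFun u' e x * φ x := by
  have key : ∀ w ψ : ℝ → ℝ, (∀ x, x ∉ Ioo a b → ψ x = 0) →
      ∫ x : G.interval e, w x * ψ x ∂(G.edgeMeasure e) = ∫ x in a..b, w x * ψ x := by
    intro w ψ hψ
    rw [intervalIntegral.integral_of_le hab.le]
    refine (integral_subtype_comap (G.measurableSet_interval e) (fun x => w x * ψ x)).trans ?_
    refine setIntegral_eq_of_subset_of_forall_sdiff_eq_zero (G.measurableSet_interval e)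
      (Ioc_subset_Icc_self.trans hsub) fun x hx => ?_
    rw [hψ x fun hx' => hx.2 (Ioo_subset_Ioc_self hx'), mul_zero]
  have h1 := h e φ hφ hφc (hφs.trans
    (interior_maximal (Ioo_subset_Icc_self.trans hsub) isOpen_Ioo))
  simp only [← edgeFun_coe] at h1
  rwa [key _ _ fun x hx => image_eq_zero_of_notMem_tsupport fun hx' =>
      hx (hφs (tsupport_deriv_subset hx')),
    key _ _ fun x hx => image_eq_zero_of_notMem_tsupport fun hx' => hx (hφs hx')] at h1

theorem IsH1.enorm_sq_sub_sq_le {u u' : G.Space → ℝ} (h : G.IsH1 u u') {e : E} {a b : ℝ}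
    (hab : a < b) (ha : a ∈ G.interval e) (hb : b ∈ G.interval e) :
    ‖G.edgeFun u e b ^ 2 - G.edgeFun u e a ^ 2‖ₑ ≤
      ∫⁻ x in G.interval e, 2 * (‖G.edgeFun u e x‖ₑ * ‖G.edgeFun u' e x‖ₑ) := by
  have hsub : Icc a b ⊆ G.interval e := (G.ordConnected_interval e).out ha hb
  have hg : IntervalIntegrable (G.edgeFun u' e) volume a b := by
    rw [intervalIntegrable_iff_integrableOn_Icc_of_le hab.le]
    exact ((memLp_edgeFun h.memLp_deriv e).mono_measure
      (Measure.restrict_mono hsub le_rfl)).integrable one_le_two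
  have hle := abs_sq_sub_sq_le_integral_of_weakDeriv hab
    ((continuousOn_edgeFun h.continuous e).mono hsub) hg
    (h.hasWeakDeriv.intervalIntegral_eq hab hsub)
  rw [intervalIntegral.integral_of_le hab.le] at hle
  calc ‖G.edgeFun u e b ^ 2 - G.edgeFun u e a ^ 2‖ₑ
      ≤ ‖∫ x in Ioc a b, 2 * |G.edgeFun u e x * G.edgeFun u' e x|‖ₑ := by
        rw [Real.enorm_eq_ofReal_abs, Real.enorm_eq_ofReal_abs]
        exact ENNReal.ofReal_le_ofReal (hle.trans (le_abs_self _))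
    _ ≤ ∫⁻ x in Ioc a b, ‖2 * |G.edgeFun u e x * G.edgeFun u' e x|‖ₑ :=
        enorm_integral_le_lintegral_enorm _
    _ = ∫⁻ x in Ioc a b, 2 * (‖G.edgeFun u e x‖ₑ * ‖G.edgeFun u' e x‖ₑ) := by
        refine lintegral_congr fun x => ?_
        have h2 : ‖(2 : ℝ)‖ₑ = 2 := by simp [Real.enorm_eq_ofReal]
        simp [← Real.norm_eq_abs, enorm_mul, h2]
    _ ≤ _ := lintegral_mono_set (Ioc_subset_Icc_self.trans hsub)

/-- The image of an edge under `u ^ 2` has measure at most the variation of `u ^ 2` there. -/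
theorem IsH1.volume_image_sq_le {u u' : G.Space → ℝ} (h : G.IsH1 u u') (e : E) :
    volume (range fun x => u (G.onEdge e x) ^ 2) ≤
      ∫⁻ x, 2 * (‖u (G.onEdge e x)‖ₑ * ‖u' (G.onEdge e x)‖ₑ) ∂(G.edgeMeasure e) := by
  have hr : ∫⁻ x, 2 * (‖u (G.onEdge e x)‖ₑ * ‖u' (G.onEdge e x)‖ₑ) ∂(G.edgeMeasure e)
      = ∫⁻ x in G.interval e, 2 * (‖G.edgeFun u e x‖ₑ * ‖G.edgeFun u' e x‖ₑ) := by
    rw [← lintegral_edgeMeasure]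
    simp only [edgeFun_coe]
  rw [hr]
  -- The measure of a set of reals is at most its diameter, so comparing two values of `u²`
  -- suffices.
  refine (Real.volume_le_diam _).trans (Metric.ediam_le ?_)
  rintro _ ⟨x, rfl⟩ _ ⟨y, rfl⟩
  simp only [← edgeFun_coe]
  rcases lt_trichotomy (x : ℝ) y with hxy | hxy | hxy
  · rw [edist_comm, edist_eq_enorm_sub]
    exact h.enorm_sq_sub_sq_le hxy x.2 y.2
  · simp [hxy]
  · rw [edist_eq_enorm_sub]
    exact h.enorm_sq_sub_sq_le hxy y.2 x.2

theorem exists_sq_lt_of_length_eq_top {u : G.Space → ℝ} (hu : MemLp u 2 volume) {e : E}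
    (he : G.length e = ⊤) {ε : ℝ} (hε : 0 < ε) : ∃ x, u (G.onEdge e x) ^ 2 < ε := by
  by_contra! hge
  have hI : G.interval e = Ici 0 := by ext; simp [interval, he]
  have hint := (memLp_two_iff_integrable_sq (memLp_edgeFun hu e).1).1 (memLp_edgeFun hu e)
  have hconst : Integrable (fun _ : ℝ => ε) (volume.restrict (G.interval e)) := by
    refine hint.mono aestronglyMeasurable_const ?_
    filter_upwards [ae_restrict_mem (G.measurableSet_interval e)] with x hx
    rw [Real.norm_of_nonneg hε.le, Real.norm_of_nonneg (sq_nonneg _),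
      edgeFun_coe u e ⟨x, hx⟩]
    exact hge ⟨x, hx⟩
  rw [integrable_const_iff, hI] at hconst
  rcases hconst with h0 | h0
  · exact hε.ne' h0
  · have := h0.measure_univ_lt_top
    simp at this

/-! ### The sup bound -/

/-- The square of an `H¹` function is bounded by the total variation of the square. -/
theorem IsH1.enorm_sq_le_lintegral [Finite E] [ConnectedSpace G.Space] [NoncompactSpace G.Space]
    {u u' : G.Space → ℝ} (h : G.IsH1 u u') (x : G.Space) :
    ‖u x‖ₑ ^ 2 ≤ ∫⁻ y, 2 * (‖u y‖ₑ * ‖u' y‖ₑ) := by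
  obtain ⟨e₀, he₀⟩ := G.exists_length_eq_top
  have hconn : (range fun y => u y ^ 2).OrdConnected :=
    (isPreconnected_range (h.continuous.pow 2)).ordConnected
  -- The value `0` is left out because `u²` need not attain it.
  have hsub : Ioc 0 (u x ^ 2) ⊆ ⋃ e, range fun y => u (G.onEdge e y) ^ 2 := by
    intro t ht
    obtain ⟨y, hy⟩ := exists_sq_lt_of_length_eq_top h.memLp he₀ ht.1
    obtain ⟨z, hz⟩ := hconn.out (mem_range_self (G.onEdge e₀ y)) (mem_range_self x) ⟨hy.le, ht.2⟩
    obtain ⟨e, w, rfl⟩ := mem_iUnion.1 (G.iUnion_range_onEdge.symm ▸ mem_univ z)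
    exact mem_iUnion.2 ⟨e, w, hz⟩
  calc ‖u x‖ₑ ^ 2 = volume (Ioc 0 (u x ^ 2)) := by
        rw [Real.volume_Ioc, sub_zero, ← enorm_pow, Real.enorm_of_nonneg (sq_nonneg _)]
    _ ≤ ∑' e, volume (range fun y => u (G.onEdge e y) ^ 2) :=
        (measure_mono hsub).trans (measure_iUnion_le _)
    _ ≤ ∑' e, ∫⁻ y, 2 * (‖u (G.onEdge e y)‖ₑ * ‖u' (G.onEdge e y)‖ₑ) ∂(G.edgeMeasure e) :=
        ENNReal.tsum_le_tsum h.volume_image_sq_le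
    _ = ∫⁻ y, 2 * (‖u y‖ₑ * ‖u' y‖ₑ) :=
        (lintegral_eq_sum_edges
          ((h.memLp.1.enorm.mul h.memLp_deriv.1.enorm).const_mul 2)).symm

theorem IsH1.enorm_sq_le [Finite E] [ConnectedSpace G.Space] [NoncompactSpace G.Space]
    {u u' : G.Space → ℝ} (h : G.IsH1 u u') (x : G.Space) :
    ‖u x‖ₑ ^ 2 ≤ 2 * (eLpNorm u 2 volume * eLpNorm u' 2 volume) := by
  refine (h.enorm_sq_le_lintegral x).trans ?_
  rw [lintegral_const_mul' _ _ ENNReal.ofNat_ne_top]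
  gcongr
  refine (ENNReal.lintegral_mul_le_Lp_mul_Lq volume (p := 2) (q := 2) ?_
    h.memLp.1.enorm h.memLp_deriv.1.enorm).trans_eq ?_
  · exact Real.HolderConjugate.two_two
  · rw [eLpNorm_eq_lintegral_rpow_enorm_toReal two_ne_zero ENNReal.ofNat_ne_top,
      eLpNorm_eq_lintegral_rpow_enorm_toReal two_ne_zero ENNReal.ofNat_ne_top]
    simp

end MetricGraph

/-! ### Interpolation and conclusion -/

theorem eLpNorm_rpow_le_of_enorm_sq_le {α : Type*} [MeasurableSpace α] {μ : Measure α}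
    {f : α → ℝ} {p : ℝ} {M : ℝ≥0∞} (hp : 2 < p) (hM : ∀ x, ‖f x‖ₑ ^ 2 ≤ M) (hMtop : M ≠ ⊤) :
    eLpNorm f (ENNReal.ofReal p) μ ^ p ≤ M ^ (p / 2 - 1) * eLpNorm f 2 μ ^ (2 : ℝ) := by
  have hp0 : 0 < p := by linarith
  have e1 : eLpNorm f (ENNReal.ofReal p) μ ^ p = ∫⁻ x, ‖f x‖ₑ ^ p ∂μ := by
    rw [eLpNorm_eq_lintegral_rpow_enorm_toReal (by simpa using hp0) ENNReal.ofReal_ne_top,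
      ENNReal.toReal_ofReal hp0.le, ← ENNReal.rpow_mul, one_div_mul_cancel hp0.ne',
      ENNReal.rpow_one]
  have e2 : eLpNorm f 2 μ ^ (2 : ℝ) = ∫⁻ x, ‖f x‖ₑ ^ (2 : ℝ) ∂μ := by
    rw [eLpNorm_eq_lintegral_rpow_enorm_toReal two_ne_zero ENNReal.ofNat_ne_top,
      ENNReal.toReal_ofNat, ← ENNReal.rpow_mul, one_div_mul_cancel two_ne_zero,
      ENNReal.rpow_one]
  rw [e1, e2, ← lintegral_const_mul' _ _
    (ENNReal.rpow_ne_top_of_nonneg (by linarith) hMtop)]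
  refine lintegral_mono fun x => ?_
  calc ‖f x‖ₑ ^ p = (‖f x‖ₑ ^ (2 : ℝ)) ^ (p / 2 - 1) * ‖f x‖ₑ ^ (2 : ℝ) := by
        rw [← ENNReal.rpow_mul, ← ENNReal.rpow_add_of_nonneg _ _ (by linarith) zero_le_two]
        congr 1; ring
    _ ≤ M ^ (p / 2 - 1) * ‖f x‖ₑ ^ (2 : ℝ) := by
        gcongr
        · linarith
        · simpa using hM x

theorem proposition2p1 (p : ℝ) (hp2 : 2 < p) (hp6 : p < 6) :
    ∃ C : ℝ≥0, 0 < C ∧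
      ∀ (V : Type*) (E : Type*) [Finite E] (G : MetricGraph V E)
        [ConnectedSpace G.Space] [NoncompactSpace G.Space] (u u' : G.Space → ℝ), G.IsH1 u u' →
          eLpNorm u (ENNReal.ofReal p) volume ^ p ≤
            C * eLpNorm u 2 volume ^ (p / 2 + 1) * eLpNorm u' 2 volume ^ (p / 2 - 1) := by
  have hq : 0 ≤ p / 2 - 1 := by linarith
  refine ⟨2 ^ (p / 2 - 1), by positivity, fun V E _ G _ _ u u' h => ?_⟩
  refine (eLpNorm_rpow_le_of_enorm_sq_le hp2 h.enorm_sq_le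
    (ENNReal.mul_ne_top ENNReal.ofNat_ne_top
      (ENNReal.mul_ne_top h.memLp.2.ne h.memLp_deriv.2.ne))).trans_eq ?_
  rw [ENNReal.mul_rpow_of_nonneg _ _ hq, ENNReal.mul_rpow_of_nonneg _ _ hq,
    ENNReal.coe_rpow_of_nonneg _ hq, show p / 2 + 1 = (p / 2 - 1) + 2 by ring,
    ENNReal.rpow_add_of_nonneg _ _ hq zero_le_two, ENNReal.coe_ofNat]
  ring
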